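/- Let $X$ be a real normed space of finite dimension $d$, let $S$ be a nonempty (possibly infinite) set, and let $p=(p_v)_{v\in S}\in X^S$ be a placement of $S$ in $X$. Let $\mathrm{Iso}(X)$ be the group of isometries of $X$. By the Mazur–Ulam theorem these are affine maps, and $\mathrm{Iso}(X)$ is regarded as a smooth submanifold of the finite-dimensional space $A(X)$ of affine maps $X\to X$ (with the norm topology). For $g\in A(X)$ write $g.p=(g(p_v))_{v\in S}$, and let $\mathcal O_p=\{g.p : g\in \mathrm{Iso}(X)\}$ be the orbit of $p$, with the smooth structure inherited from the finite-dimensional linear subspace $A_p=\{h.p : h\in A(X)\}$ of $X^S$, which carries the topology induced by the product topology of $X^S$. Let $\mathcal T(p)\subseteq X^S$ be the set of trivial infinitesimal motions of $p$: those $u\in X^S$ for which there are $\delta>0$ and continuous paths $\alpha_v:(-\delta,\delta)\to X$ $(v\in S)$, differentiable at $0$, such that $\alpha_v(0)=p_v$ and $\alpha_v'(0)=u_v$ for all $v\in S$, and $(\alpha_v(t))_{v\in S}\in\mathcal O_p$ for all $t\in(-\delta,\delta)$. Call $p$ full if the orbit map $\phi_p:\mathrm{Iso}(X)\to\mathcal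 O_p$, $g\mapsto g.p$, is a smooth local diffeomorphism. Then $\mathrm{Iso}(X)$ is a smooth manifold of a well-defined finite dimension, $\mathcal T(p)$ is a finite-dimensional linear subspace of $X^S$, and $$d\le \dim\mathcal T(p)\le \dim \mathrm{Iso}(X),$$ with $\dim\mathcal T(p)=\dim\mathrm{Iso}(X)$ if and only if $p$ is full. -/

import Mathlib

open Set Module
open scoped ContDiff

/-! ### Smooth maps and smooth manifolds inside finite dimensional real vector spaces

`E` and `F` are finite dimensional Hausdorff real topological vector spaces; their smooth structure
is the one given by any linear coordinates, here `toEuclidean`. -/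

section Smooth

variable {E : Type*} [AddCommGroup E] [Module ℝ E] [TopologicalSpace E] [IsTopologicalAddGroup E]
  [ContinuousSMul ℝ E] [T2Space E] [FiniteDimensional ℝ E]
  {F : Type*} [AddCommGroup F] [Module ℝ F] [TopologicalSpace F] [IsTopologicalAddGroup F]
  [ContinuousSMul ℝ F] [T2Space F] [FiniteDimensional ℝ F]

/-- `f` is `C^∞` on the open set `U`, in linear coordinates. -/
def SmoothOnOpen (f : E → F) (U : Set E) : Prop :=
  IsOpen U ∧
    ContDiffOn ℝ ∞ (fun x => toEuclidean (f (toEuclidean.symm x)))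
      ((toEuclidean : E ≃L[ℝ] _) '' U)

/-- The restriction of `f` to an arbitrary subset `M` is smooth: near each point of `M` it extends
to a smooth map on an open subset of the ambient space. -/
def SmoothOnSubset (f : E → F) (M : Set E) : Prop :=
  ∀ x ∈ M, ∃ U : Set E, x ∈ U ∧ ∃ g : E → F, SmoothOnOpen g U ∧ EqOn f g (M ∩ U)

/-- `f` restricts to a smooth diffeomorphism of the subset `M` of `E` onto the subset `N` of `F`. -/
def IsDiffeoOn (f : E → F) (M : Set E) (N : Set F) : Prop :=
  MapsTo f M N ∧ SmoothOnSubset f M ∧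
    ∃ g : F → E, MapsTo g N M ∧ SmoothOnSubset g N ∧ InvOn g f M N

/-- `f` restricts to a smooth local diffeomorphism from `M` to `N`: every point of `M` has a
relatively open neighbourhood which `f` maps diffeomorphically onto a relatively open subset
of `N`. -/
def IsLocalDiffeoOn (f : E → F) (M : Set E) (N : Set F) : Prop :=
  MapsTo f M N ∧
    ∀ x ∈ M, ∃ U : Set E, ∃ V : Set F, IsOpen U ∧ IsOpen V ∧ x ∈ U ∧
      IsDiffeoOn f (M ∩ U) (N ∩ V)

/-- The subset `M` of `E` is a smooth (embedded) manifold of dimension `n`: every point has a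
relatively open neighbourhood in `M` diffeomorphic to an open subset of `ℝⁿ`. -/
def IsSmoothManifoldOfDim (M : Set E) (n : ℕ) : Prop :=
  ∀ x ∈ M, ∃ U : Set E, ∃ W : Set (EuclideanSpace ℝ (Fin n)), IsOpen U ∧ IsOpen W ∧ x ∈ U ∧
    ∃ f : E → EuclideanSpace ℝ (Fin n), IsDiffeoOn f (M ∩ U) W

end Smooth

/-! ### Isometries, placements, orbits and trivial motions -/

section Placement

variable (X : Type*) [NormedAddCommGroup X] [NormedSpace ℝ X]

instance instFiniteDimensionalContinuousAffineMap [FiniteDimensional ℝ X] :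
    FiniteDimensional ℝ (X →ᴬ[ℝ] X) :=
  (ContinuousAffineMap.decompLinearIsometryEquiv ℝ ℝ X X).toLinearEquiv.symm.finiteDimensional

/-- The isometry group of `X` as a subset of the space `A(X)` of affine maps with its norm topology.
By the Mazur-Ulam theorem every isometry is affine, see `exists_mem_isoSet`. -/
def isoSet : Set (X →ᴬ[ℝ] X) :=
  {h | ∃ g : X ≃ᵢ X, ∀ x, h x = g x}

variable {X}

theorem exists_mem_isoSet (g : X ≃ᵢ X) : ∃ h ∈ isoSet X, ∀ x, h x = g x :=
  ⟨g.toRealAffineIsometryEquiv.toContinuousAffineEquiv.toContinuousAffineMap,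
    ⟨g, fun _ => rfl⟩, fun _ => rfl⟩

variable {S : Type*}

/-- The orbit `O_p = {g.p : g ∈ Iso(X)}` of a placement `p`, in `X^S`. -/
def orbitSet (p : S → X) : Set (S → X) :=
  {x | ∃ g : X ≃ᵢ X, ∀ v, x v = g (p v)}

/-- The trivial infinitesimal motions `T(p)` of `p`: velocities at `t = 0` of continuous paths
`α` through `p` in the orbit of `p` (paths `(-δ, δ) → X^S`; values outside are irrelevant). -/
def trivialMotions (p : S → X) : Set (S → X) :=
  {u | ∃ δ : ℝ, 0 < δ ∧ ∃ α : S → ℝ → X,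
    (∀ v, ContinuousOn (α v) (Ioo (-δ) δ)) ∧ (∀ v, α v 0 = p v) ∧
    (∀ t ∈ Ioo (-δ) δ, (fun v => α v t) ∈ orbitSet p) ∧
    ∀ v, HasDerivAt (α v) (u v) 0}

/-- The linear map `A(X) → X^S`, `h ↦ h.p = (h(p_v))_v`. -/
def affineAct (p : S → X) : (X →ᴬ[ℝ] X) →ₗ[ℝ] (S → X) where
  toFun h := fun v => h (p v)
  map_add' _ _ := rfl
  map_smul' _ _ := rfl

/-- The linear space `A_p = {h.p : h ∈ A(X)} ⊆ X^S`, with the product topology. It is finite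
dimensional and contains the orbit of `p`, even when `S` is infinite. -/
abbrev affineOrbit (p : S → X) : Submodule ℝ (S → X) := LinearMap.range (affineAct p)

theorem orbitSet_subset_affineOrbit (p : S → X) : orbitSet p ⊆ affineOrbit p := by
  rintro x ⟨g, hg⟩
  obtain ⟨h, -, hh⟩ := exists_mem_isoSet g
  exact ⟨h, funext fun v => (hh (p v)).trans (hg v).symm⟩

/-- The placement `p` is full: the orbit map `Iso(X) → O_p`, `g ↦ g.p`, is a smooth local
diffeomorphism, with `Iso(X) ⊆ A(X)` and `O_p ⊆ A_p`. -/
def IsFull [FiniteDimensional ℝ X] (p : S → X) : Prop :=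
  IsLocalDiffeoOn (F := affineOrbit p) (affineAct p).rangeRestrict (isoSet X)
    (Subtype.val ⁻¹' orbitSet p)

end Placement

/-! ### Closed subgroups of finite dimensional algebras, isometry groups and their orbits -/

/-! ### The Lie algebra of a closed subgroup of an algebra. -/

section ClosedSubgroup

open Filter Topology NormedSpace

variable {A : Type*} [NormedRing A] [NormedAlgebra ℝ A] [CompleteSpace A]

/-! By Mazur–Ulam, an isometry of `X` is a translation composed with an element of the compact group
K of linear isometries. Let L be the set of B with exp(tB) in K for all t. Von Neumann's closed
subgroup argument shows that L is a linear subspace and that exp parametrizes K near 1 by L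
(`exists_exp_chart`). Left translates of this chart, together with translations, give charts of
Iso(X) modelled on X × L (`exists_iso_chart`). Its dimension is therefore dim X + dim L, and
differentiating a change of charts shows that no other dimension is possible.

The central claim is that T(p) is the range of the linear map `tangentAct p`, (b, B) ↦ (B p_v +
b)_v. One inclusion differentiates the paths t ↦ exp(tB) p_v + tb. In the other, the given path is
differentiable only at 0 and comes with no differentiable lift to the group. Its values at a
sequence of times are lifted to elements of K as close to 1 as possible. Compactness and this
minimality bound the difference quotients of the lifts along a subsequence, and a limit point is the
required B (`exists_mem_lieSubmodule_of_tendsto`).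

The bounds follow: translations embed X in T(p), and a range is no larger than its source. By
rank–nullity, equality on the right means that `tangentAct p` is injective. This is equivalent to
fullness. If p is full, differentiating a local inverse of the orbit map at the identity gives
injectivity. Conversely, injectivity makes the orbit map an immersion, and compactness of K makes it
open onto the orbit, so its local inverses are smooth (`isFull_of_injective`). -/

theorem contDiff_normedSpace_exp {n : WithTop ℕ∞} : ContDiff ℝ n (exp : A → A) :=
  AnalyticOnNhd.contDiff fun x _ => exp_analytic x

theorem exp_add_smul (s t : ℝ) (B : A) : exp ((s + t) • B) = exp (s • B) * exp (t • B) := by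
  let _ := NormedAlgebra.restrictScalars ℚ ℝ A
  rw [add_smul, exp_add_of_commute (((Commute.refl B).smul_left s).smul_right t)]

theorem exp_mul_exp_neg (B : A) : exp B * exp (-B) = 1 := by
  simpa using (exp_add_smul 1 (-1) B).symm

theorem exp_neg_mul_exp (B : A) : exp (-B) * exp B = 1 := by
  simpa using exp_mul_exp_neg (-B)

theorem hasStrictFDerivAt_normedSpace_exp :
    HasStrictFDerivAt (exp : A → A) (ContinuousLinearEquiv.refl ℝ A : A →L[ℝ] A) 0 :=
  hasStrictFDerivAt_exp_zero

/-- A sequence which converges when multiplied by scalars tending to infinity tends to zero. -/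
theorem tendsto_zero_of_tendsto_smul {E ι : Type*} [AddCommGroup E] [Module ℝ E]
    [TopologicalSpace E] [ContinuousSMul ℝ E]
    {l : Filter ι} {c : ι → ℝ} {d : ι → E} {B : E}
    (hc : Tendsto c l atTop) (h : Tendsto (fun n => c n • d n) l (𝓝 B)) :
    Tendsto d l (𝓝 0) := by
  have h1 : Tendsto (fun n => (c n)⁻¹ • c n • d n) l (𝓝 ((0 : ℝ) • B)) :=
    (tendsto_inv_atTop_zero.comp hc).smul h
  rw [zero_smul] at h1
  refine h1.congr' ?_
  filter_upwards [hc.eventually_gt_atTop 0] with n hn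
  rw [smul_smul, inv_mul_cancel₀ hn.ne', one_smul]

/-- With log the local inverse of exp, c_n log a_n also tends to B. Hence the powers of a_n with
exponent ⌊t c_n⌋, which lie in K, tend to exp(tB), and K is closed. -/
theorem exp_mem_of_tendsto {K : Submonoid A} (hK : IsClosed (K : Set A)) {ι : Type*}
    {l : Filter ι} [l.NeBot] {a : ι → A} {c : ι → ℝ} {B : A} (ha : ∀ n, a n ∈ K)
    (hc : Tendsto c l atTop) (h : Tendsto (fun n => c n • (a n - 1)) l (𝓝 B))
    {t : ℝ} (ht : 0 ≤ t) : exp (t • B) ∈ K := by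
  let _ := NormedAlgebra.restrictScalars ℚ ℝ A
  have hs := hasStrictFDerivAt_normedSpace_exp (A := A)
  set g := hs.localInverse with hg
  have hd := tendsto_zero_of_tendsto_smul hc h
  have ha1 : Tendsto a l (𝓝 1) := by simpa using hd.add_const 1
  have hgd : HasFDerivAt g (ContinuousLinearMap.id ℝ A) 1 := by
    have := hs.to_localInverse.hasFDerivAt
    simpa using this
  have hg1 : g 1 = 0 := by simpa using hs.localInverse_apply_image
  have hexp : ∀ᶠ n in l, exp (g (a n)) = a n := by
    have := hs.eventually_right_inverse
    rw [exp_zero] at this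
    exact ha1.eventually this
  have h2 : Tendsto (fun n => c n • g (a n)) l (𝓝 B) := by
    have := hgd.hasFDerivWithinAt (s := univ) |>.lim hd (by simp) h
    simpa [hg1] using this
  have h3 : Tendsto (fun n => ⌊t * c n⌋₊ • g (a n)) l (𝓝 (t • B)) := by
    have := ((tendsto_nat_floor_mul_div_atTop ht).comp hc).smul h2
    refine this.congr' ?_
    filter_upwards [hc.eventually_gt_atTop 0] with n hn
    simp only [Function.comp, smul_smul]
    rw [div_mul_cancel₀ _ hn.ne', Nat.cast_smul_eq_nsmul]
  refine hK.mem_of_tendsto h3.exp ?_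
  filter_upwards [hexp] with n hn
  rw [exp_nsmul, hn]
  exact pow_mem (ha n) _

/-- Every element of the submonoid `K` has a two-sided inverse in `K`. -/
def HasInverses (K : Submonoid A) : Prop :=
  ∀ a ∈ K, ∃ b ∈ K, a * b = 1 ∧ b * a = 1

theorem HasInverses.exp_neg_mem {K : Submonoid A} (hi : HasInverses K) {B : A}
    (h : exp B ∈ K) : exp (-B) ∈ K := by
  obtain ⟨b, hb, -, h1⟩ := hi _ h
  rwa [← left_inv_eq_right_inv h1 (exp_mul_exp_neg B)]

theorem exp_smul_mem_of_tendsto {K : Submonoid A} (hK : IsClosed (K : Set A))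
    (hi : HasInverses K) {ι : Type*}
    {l : Filter ι} [l.NeBot] {a : ι → A} {c : ι → ℝ} {B : A} (ha : ∀ n, a n ∈ K)
    (hc : Tendsto c l atTop) (h : Tendsto (fun n => c n • (a n - 1)) l (𝓝 B))
    (t : ℝ) : exp (t • B) ∈ K := by
  rcases le_total 0 t with ht | ht
  · exact exp_mem_of_tendsto hK ha hc h ht
  · have := hi.exp_neg_mem (exp_mem_of_tendsto hK ha hc h (neg_nonneg.2 ht))
    simpa using this

/-- The Lie algebra of a closed group `K` in a finite dimensional algebra. -/
def lieSubmodule (K : Submonoid A) (hK : IsClosed (K : Set A)) (hi : HasInverses K) :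
    Submodule ℝ A where
  carrier := {B | ∀ t : ℝ, exp (t • B) ∈ K}
  zero_mem' t := by simp [K.one_mem]
  smul_mem' s B hB t := by rw [smul_smul]; exact hB _
  add_mem' {B C} hB hC := by
    have hd : HasDerivAt (fun t : ℝ => exp (t • B) * exp (t • C)) (B + C) 0 := by
      have := (hasDerivAt_exp_smul_const (𝕂 := ℝ) B 0).fun_mul (hasDerivAt_exp_smul_const (𝕂 := ℝ) C 0)
      simpa using this
    -- The curve exp(tB) exp(tC) lies in K and has velocity B + C at 0; its difference quotients at
    -- times 1/s exhibit B + C as a limit direction of K.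
    have hl := hd.hasFDerivAt.lim_real 1
    refine exp_smul_mem_of_tendsto hK hi (l := atTop) (c := id)
      (a := fun s : ℝ => exp (s⁻¹ • B) * exp (s⁻¹ • C)) (fun s => mul_mem (hB _) (hC _))
      tendsto_id ?_
    simpa using hl

theorem mem_lieSubmodule {K : Submonoid A} {hK : IsClosed (K : Set A)} {hi : HasInverses K}
    {B : A} : B ∈ lieSubmodule K hK hi ↔ ∀ t : ℝ, exp (t • B) ∈ K := Iff.rfl

theorem exp_mem_of_mem_lieSubmodule {K : Submonoid A} {hK : IsClosed (K : Set A)}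
    {hi : HasInverses K} {B : A} (h : B ∈ lieSubmodule K hK hi) : exp B ∈ K := by
  simpa using h 1

theorem mem_lieSubmodule_of_tendsto {K : Submonoid A} (hK : IsClosed (K : Set A))
    (hi : HasInverses K) {ι : Type*}
    {l : Filter ι} [l.NeBot] {a : ι → A} {c : ι → ℝ} {B : A} (ha : ∀ n, a n ∈ K)
    (hc : Tendsto c l atTop) (h : Tendsto (fun n => c n • (a n - 1)) l (𝓝 B)) :
    B ∈ lieSubmodule K hK hi :=
  exp_smul_mem_of_tendsto hK hi ha hc h

/-- A sequence of nonzero vectors tending to zero has a subsequence of convergent directions. -/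
theorem exists_subseq_tendsto_direction {E : Type*} [NormedAddCommGroup E] [NormedSpace ℝ E]
    [FiniteDimensional ℝ E] {b : ℕ → E} (hb : ∀ n, b n ≠ 0) :
    ∃ B : E, ‖B‖ = 1 ∧ ∃ φ : ℕ → ℕ, StrictMono φ ∧
      Tendsto (fun n => ‖b (φ n)‖⁻¹ • b (φ n)) atTop (𝓝 B) := by
  have := FiniteDimensional.proper ℝ E
  have hs : ∀ n, ‖b n‖⁻¹ • b n ∈ Metric.sphere (0 : E) 1 := fun n => by
    simp [norm_smul, inv_mul_cancel₀ (norm_ne_zero_iff.2 (hb n))]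
  obtain ⟨B, hB, φ, hφ, h⟩ := (isCompact_sphere (0 : E) 1).tendsto_subseq hs
  exact ⟨B, by simpa using hB, φ, hφ, h⟩

theorem tendsto_inv_norm_atTop {E ι : Type*} [NormedAddCommGroup E] {l : Filter ι} {b : ι → E}
    (h0 : ∀ n, b n ≠ 0) (hb : Tendsto b l (𝓝 0)) : Tendsto (fun n => ‖b n‖⁻¹) l atTop := by
  refine tendsto_inv_nhdsGT_zero.comp (tendsto_nhdsWithin_iff.2 ⟨?_, ?_⟩)
  · simpa using hb.norm
  · exact Eventually.of_forall fun n => norm_pos_iff.2 (h0 n)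

end ClosedSubgroup

/-! ### The exponential chart of a closed subgroup. -/

section ExpChart

open Filter Topology NormedSpace

/-- The inverse function theorem for analytic maps, with an inverse smooth on the whole target. -/
theorem exists_openPartialHomeomorph_contDiffOn_symm {E F : Type*} [NormedAddCommGroup E]
    [NormedSpace ℝ E] [CompleteSpace E] [NormedAddCommGroup F] [NormedSpace ℝ F] {f : E → F}
    {x : E} {f' : E ≃L[ℝ] F} (hf : ContDiff ℝ ω f) (hf' : HasFDerivAt f (f' : E →L[ℝ] F) x) :
    ∃ Φ : OpenPartialHomeomorph E F, (Φ : E → F) = f ∧ x ∈ Φ.source ∧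
      ContDiffOn ℝ ω Φ.symm Φ.target := by
  have hx : ContDiffAt ℝ ω f x := hf.contDiffAt
  have h0 : (ω : WithTop ℕ∞) ≠ 0 := by simp
  set Φ₀ := hx.toOpenPartialHomeomorph f hf' h0 with hΦ
  -- Analyticity at a point is an open condition, so the target can be shrunk to the points where
  -- the inverse is analytic.
  have hT : IsOpen {y | ContDiffAt ℝ ω Φ₀.symm y} :=
    isOpen_iff_mem_nhds.2 fun y hy => ContDiffAt.eventually hy (by simp)
  have hxs : x ∈ Φ₀.source := hx.mem_toOpenPartialHomeomorph_source hf' h0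
  refine ⟨(Φ₀.symm.restrOpen _ hT).symm, rfl, ?_, ?_⟩
  · have : ContDiffAt ℝ ω Φ₀.symm (f x) := hx.to_localInverse hf' h0
    exact ⟨hxs, this⟩
  · intro y hy
    exact ContDiffAt.contDiffWithinAt hy.2

variable {A : Type*} [NormedRing A] [NormedAlgebra ℝ A] [FiniteDimensional ℝ A] [CompleteSpace A]
  {K : Submonoid A} (hK : IsClosed (K : Set A)) (hi : HasInverses K)

/-- If `exp b n ∈ K` with `b n` nonzero in a complement `N` of the Lie algebra, then `b n` does
not tend to zero. -/
theorem not_tendsto_of_exp_mem {N : Submodule ℝ A} (hN : Disjoint (lieSubmodule K hK hi) N)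
    {b : ℕ → N} (hb : ∀ n, b n ≠ 0) (hexp : ∀ n, exp (b n : A) ∈ K) :
    ¬ Tendsto b atTop (𝓝 0) := by
  intro h0
  obtain ⟨B, hB, φ, hφ, hlim⟩ := exists_subseq_tendsto_direction hb
  have hb0 : Tendsto (fun n => ((b (φ n) : N) : A)) atTop (𝓝 0) := by
    simpa [Function.comp_def] using
      (N.subtypeL.continuous.tendsto 0).comp (h0.comp hφ.tendsto_atTop)
  have hlim' : Tendsto (fun n => ‖b (φ n)‖⁻¹ • ((b (φ n) : N) : A)) atTop (𝓝 (B : A)) :=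
    (N.subtypeL.continuous.tendsto B).comp hlim
  have hc := tendsto_inv_norm_atTop (fun n => hb (φ n)) (h0.comp hφ.tendsto_atTop)
  have := hasStrictFDerivAt_normedSpace_exp (A := A) |>.hasFDerivAt.hasFDerivWithinAt
    (s := univ) |>.lim hb0 (by simp) hlim'
  simp only [zero_add, exp_zero, ContinuousLinearEquiv.coe_refl,
    ContinuousLinearMap.id_apply] at this
  have hmem := mem_lieSubmodule_of_tendsto hK hi (fun n => hexp (φ n)) hc this
  have : (B : A) = 0 := Submodule.disjoint_def.1 hN _ hmem B.2
  have hB0 : B = 0 := by ext; simpa using this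
  simp [hB0] at hB

/-- Near the identity, a closed group is parametrized by the exponential of its Lie algebra. -/
theorem exists_exp_chart :
    ∃ (U : Set A) (W : Set (lieSubmodule K hK hi)) (ψ : A → lieSubmodule K hK hi),
      IsOpen U ∧ 1 ∈ U ∧ IsOpen W ∧ 0 ∈ W ∧ ContDiffOn ℝ ω ψ U ∧
      (∀ w ∈ W, exp (w : A) ∈ U ∧ ψ (exp (w : A)) = w) ∧
      ∀ a ∈ K, a ∈ U → ψ a ∈ W ∧ exp (ψ a : A) = a := by
  obtain ⟨N, hN⟩ := (lieSubmodule K hK hi).exists_isCompl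
  set L := lieSubmodule K hK hi with hL
  -- The derivative of this map at 0 is the sum isomorphism L × N ≃ A, so it is a local
  -- diffeomorphism; it remains to see that K is cut out by vanishing of the N-coordinate.
  let f : L × N → A := fun x => exp (x.1 : A) * exp (x.2 : A)
  have hf : ContDiff ℝ ω f :=
    (contDiff_normedSpace_exp.comp (L.subtypeL.contDiff.comp contDiff_fst)).mul
      (contDiff_normedSpace_exp.comp (N.subtypeL.contDiff.comp contDiff_snd))
  let f' : (L × N) ≃L[ℝ] A := (L.prodEquivOfIsCompl N hN).toContinuousLinearEquiv
  have hf' : HasFDerivAt f (f' : L × N →L[ℝ] A) 0 := by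
    have he : HasFDerivAt (exp : A → A) (ContinuousLinearMap.id ℝ A) 0 :=
      hasStrictFDerivAt_normedSpace_exp.hasFDerivAt
    have h1 : HasFDerivAt (fun x : L × N => exp (x.1 : A))
        (L.subtypeL.comp (ContinuousLinearMap.fst ℝ L N)) 0 := by
      have hl := (L.subtypeL.comp (ContinuousLinearMap.fst ℝ L N)).hasFDerivAt (x := 0)
      exact HasFDerivAt.comp (g := (exp : A → A)) 0 (by rwa [map_zero]) hl
    have h2 : HasFDerivAt (fun x : L × N => exp (x.2 : A))
        (N.subtypeL.comp (ContinuousLinearMap.snd ℝ L N)) 0 := by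
      have hl := (N.subtypeL.comp (ContinuousLinearMap.snd ℝ L N)).hasFDerivAt (x := 0)
      exact HasFDerivAt.comp (g := (exp : A → A)) 0 (by rwa [map_zero]) hl
    convert! h1.mul' h2 using 1
    ext x <;> simp [f']
  obtain ⟨Φ, hΦ, h0, hs⟩ := exists_openPartialHomeomorph_contDiffOn_symm hf hf'
  have hf0 : f 0 = 1 := by simp [f]
  have h1t : (1 : A) ∈ Φ.target := by
    have := Φ.map_source h0
    rwa [hΦ, hf0] at this
  have hsymm1 : Φ.symm 1 = 0 := by
    have := Φ.left_inv h0
    rwa [hΦ, hf0] at this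
  -- Otherwise elements of K tending to 1 have nonzero N-coordinates; dividing off the factor from L
  -- leaves exponentials in K of nonzero elements of N tending to 0.
  have key : ∀ᶠ a in 𝓝 (1 : A), a ∈ K → (Φ.symm a).2 = 0 := by
    by_contra hcon
    obtain ⟨a, ha, hfr⟩ := exists_seq_forall_of_frequently
      ((not_eventually.1 hcon).and_eventually (Φ.open_target.mem_nhds h1t))
    have hcont : Tendsto (fun n => Φ.symm (a n)) atTop (𝓝 0) := by
      rw [← hsymm1]
      exact (Φ.continuousAt_symm h1t).tendsto.comp ha
    refine not_tendsto_of_exp_mem hK hi hN.disjoint (b := fun n => (Φ.symm (a n)).2)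
      (fun n h => (hfr n).1 fun _ => h) (fun n => ?_) ((continuous_snd.tendsto _).comp hcont)
    have hr : exp ((Φ.symm (a n)).1 : A) * exp ((Φ.symm (a n)).2 : A) = a n := by
      have := Φ.right_inv (hfr n).2
      rwa [hΦ] at this
    have hmem : exp (-((Φ.symm (a n)).1 : A)) * a n ∈ K :=
      mul_mem (exp_mem_of_mem_lieSubmodule (neg_mem (Φ.symm (a n)).1.2))
        (by by_contra h; exact (hfr n).1 fun h' => absurd h' h)
    generalize Φ.symm (a n) = y at hr hmem ⊢
    rwa [← hr, ← mul_assoc, exp_neg_mul_exp, one_mul] at hmem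
  obtain ⟨U₀, hU₀, hU₀o, h1U₀⟩ := eventually_nhds_iff.1 key
  have hg : Continuous fun w : L => (w, (0 : N)) := by fun_prop
  have hexpw : ∀ w : L, f (w, 0) = exp (w : A) := fun w => by simp [f]
  have hec : Continuous fun w : L => exp (w : A) :=
    (contDiff_normedSpace_exp (n := 0)).continuous.comp continuous_subtype_val
  refine ⟨U₀ ∩ Φ.target, {w | exp (w : A) ∈ U₀ ∧ (w, (0 : N)) ∈ Φ.source},
    fun a => (Φ.symm a).1, hU₀o.inter Φ.open_target, ⟨h1U₀, h1t⟩,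
    (hU₀o.preimage hec).inter (Φ.open_source.preimage hg), ⟨by simpa using h1U₀, h0⟩,
    contDiff_fst.comp_contDiffOn (hs.mono inter_subset_right), ?_, ?_⟩
  · rintro w ⟨hw1, hw2⟩
    have hw3 := Φ.map_source hw2
    have hw4 := Φ.left_inv hw2
    rw [hΦ, hexpw] at hw3 hw4
    exact ⟨⟨hw1, hw3⟩, by simp [hw4]⟩
  · rintro a haK ⟨haU, hat⟩
    have h2 : ((Φ.symm a).1, (0 : N)) = Φ.symm a := Prod.ext rfl (hU₀ a haU haK).symm
    have h3 : exp ((Φ.symm a).1 : A) = a := by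
      have := Φ.right_inv hat
      rwa [hΦ, ← h2, hexpw] at this
    exact ⟨⟨by rwa [h3], by rw [h2]; exact Φ.map_target hat⟩, h3⟩

end ExpChart

/-! ### Velocities along the orbit of a compact group. -/

section OrbitVelocity

open Filter Topology NormedSpace

variable {A : Type*} [NormedRing A] [NormedAlgebra ℝ A]
  {Y : Type*} [AddCommGroup Y] [Module ℝ Y] [TopologicalSpace Y] [T2Space Y]
  {K : Submonoid A}

/-- Replaces each a_n by a point of its fibre of T in K that is closest to 1. The hypothesis `hT`
says that T (c * a) depends only on c and T a, so T behaves as an orbit map and its fibres in K are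
cosets of a stabilizer. -/
theorem exists_minimal_seq (hc : IsCompact (K : Set A)) (hi : HasInverses K) {T : A →L[ℝ] Y}
    (hT : ∀ c a, T a = 0 → T (c * a) = 0) {a : ℕ → A} (ha : ∀ n, a n ∈ K)
    (hlim : Tendsto (fun n => T (a n)) atTop (𝓝 (T 1))) :
    ∃ φ : ℕ → ℕ, StrictMono φ ∧ ∃ d : ℕ → A, Tendsto d atTop (𝓝 1) ∧
      ∀ n, d n ∈ K ∧ T (d n) = T (a (φ n)) ∧
        ∀ b ∈ K, T b = T (d n) → ‖d n - 1‖ ≤ ‖b - 1‖ := by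
  have hT' : ∀ c a b, T a = T b → T (c * a) = T (c * b) := fun c a b h => by
    have := hT c (a - b) (by rw [map_sub, h, sub_self])
    rwa [mul_sub, map_sub, sub_eq_zero] at this
  have hex : ∀ n, ∃ b ∈ K, T b = T (a n) ∧ ∀ b' ∈ K, T b' = T b → ‖b - 1‖ ≤ ‖b' - 1‖ := by
    intro n
    have hcl : IsClosed {b | T b = T (a n)} := isClosed_eq T.continuous continuous_const
    obtain ⟨b, hb, hmin⟩ := (hc.inter_right hcl).exists_isMinOn ⟨a n, ha n, rfl⟩
      (f := fun b => ‖b - 1‖) (by fun_prop)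
    exact ⟨b, hb.1, hb.2, fun b' hb' h => hmin ⟨hb', h.trans hb.2⟩⟩
  choose b hbK hbT hmin using hex
  obtain ⟨z, hz, φ, hφ, hbz⟩ := hc.tendsto_subseq hbK
  have hTz : T z = T 1 := by
    refine tendsto_nhds_unique ((T.continuous.tendsto z).comp hbz) ?_
    refine (hlim.comp hφ.tendsto_atTop).congr fun n => ?_
    simp [hbT]
  obtain ⟨y, hy, hzy, hyz⟩ := hi z hz
  refine ⟨φ, hφ, fun n => b (φ n), ?_, fun n => ⟨hbK _, hbT _, hmin _⟩⟩
  have hTy : T y = T 1 := by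
    have := hT' y _ _ hTz
    rwa [hyz, mul_one, eq_comm] at this
  -- If z is the limit of the minimizers, its inverse y stabilizes T 1. Thus b_n y lies in the fibre
  -- of b_n, and minimality gives ‖b_n - 1‖ ≤ ‖b_n y - 1‖ → 0.
  rw [tendsto_iff_norm_sub_tendsto_zero]
  refine squeeze_zero (fun _ => norm_nonneg _)
    (fun n => hmin (φ n) (b (φ n) * y) (mul_mem (hbK _) hy) ?_) ?_
  · rw [hT' _ _ _ hTy, mul_one]
  · rw [← tendsto_iff_norm_sub_tendsto_zero, ← hzy]
    exact hbz.mul_const y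

variable [CompleteSpace A]

/-- If the kernel of `T` is a left ideal which contains `B` then `T (exp B) = T 1`. -/
theorem map_exp_eq_map_one {T : A →L[ℝ] Y} (hT : ∀ c a, T a = 0 → T (c * a) = 0) {B : A}
    (hB : T B = 0) : T (exp B) = T 1 := by
  have h1 := (exp_series_hasSum_exp' (𝕂 := ℝ) B).mapL T
  refine h1.unique ?_
  convert hasSum_single (f := fun n : ℕ => T (((n.factorial : ℝ)⁻¹) • B ^ n)) 0 ?_ using 1
  · simp
  · rintro (_ | n) hn
    · exact absurd rfl hn
    · simp [pow_succ, hT _ _ hB]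

variable [FiniteDimensional ℝ A] [IsTopologicalAddGroup Y] [ContinuousSMul ℝ Y]

/-- Velocities at `1` of the orbit `T '' K` of a compact group come from its Lie algebra. -/
theorem exists_mem_lieSubmodule_of_tendsto (hc : IsCompact (K : Set A)) (hi : HasInverses K)
    {T : A →L[ℝ] Y} (hT : ∀ c a, T a = 0 → T (c * a) = 0) {a : ℕ → A} (ha : ∀ n, a n ∈ K)
    {c : ℕ → ℝ} (hcl : Tendsto c atTop atTop) {u : Y}
    (hlim : Tendsto (fun n => c n • (T (a n) - T 1)) atTop (𝓝 u)) :
    ∃ B ∈ lieSubmodule K hc.isClosed hi, T B = u := by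
  have hlim0 : Tendsto (fun n => T (a n)) atTop (𝓝 (T 1)) := by
    simpa using (tendsto_zero_of_tendsto_smul hcl hlim).add_const (T 1)
  obtain ⟨φ, hφ, d, hd1, hd⟩ := exists_minimal_seq hc hi hT ha hlim0
  have hcφ := hcl.comp hφ.tendsto_atTop
  have hlimφ : Tendsto (fun n => c (φ n) • (T (d n) - T 1)) atTop (𝓝 u) :=
    (hlim.comp hφ.tendsto_atTop).congr fun n => by simp [(hd n).2.1]
  -- If the difference quotients are bounded infinitely often, a limit point is the required B.
  -- Otherwise their norms tend to infinity, which will contradict minimality.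
  by_cases hb : ∃ R, ∃ᶠ n in atTop, c (φ n) • (d n - 1) ∈ Metric.closedBall (0 : A) R
  · obtain ⟨R, hR⟩ := hb
    have := FiniteDimensional.proper ℝ A
    obtain ⟨B, -, σ, hσ, hB⟩ := tendsto_subseq_of_frequently_bounded Metric.isBounded_closedBall hR
    refine ⟨B, mem_lieSubmodule_of_tendsto hc.isClosed hi (fun n => (hd (σ n)).1)
      (hcφ.comp hσ.tendsto_atTop) hB, ?_⟩
    refine tendsto_nhds_unique ((T.continuous.tendsto B).comp hB) ?_
    refine (hlimφ.comp hσ.tendsto_atTop).congr fun n => ?_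
    simp
  · exfalso
    push Not at hb
    have hbig : Tendsto (fun n => ‖c (φ n) • (d n - 1)‖) atTop atTop := by
      refine tendsto_atTop.2 fun R => (hb R).mono fun n hn => ?_
      simpa using (not_le.1 (by simpa using hn)).le
    obtain ⟨N, hN⟩ := ((hbig.eventually_gt_atTop 0)).exists_forall_of_atTop
    have hne : ∀ n, d (n + N) - 1 ≠ 0 := fun n h => by
      have := hN (n + N) (Nat.le_add_left _ _)
      rw [h] at this
      simp at this
    obtain ⟨B, hB1, σ', hσ', hB⟩ := exists_subseq_tendsto_direction hne
    set σ : ℕ → ℕ := fun n => σ' n + N with hσdef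
    have hσ : Tendsto σ atTop atTop := (tendsto_add_atTop_nat N).comp hσ'.tendsto_atTop
    set r : ℕ → ℝ := fun n => ‖d (σ n) - 1‖ with hr
    have hrpos : ∀ n, 0 < r n := fun n => norm_pos_iff.2 (hne _)
    have hr0 : Tendsto r atTop (𝓝 0) := by
      simpa using ((hd1.comp hσ).sub_const 1).norm
    have hrinv : Tendsto (fun n => (r n)⁻¹) atTop atTop :=
      tendsto_inv_norm_atTop (fun n => hne (σ' n)) (by simpa using (hd1.comp hσ).sub_const 1)
    have hBmem : B ∈ lieSubmodule K hc.isClosed hi :=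
      mem_lieSubmodule_of_tendsto hc.isClosed hi (fun n => (hd (σ n)).1) hrinv hB
    -- On normalized differences, T is the convergent quotient divided by a norm tending to
    -- infinity. So the limiting direction B is tangent to the stabilizer.
    have hTB : T B = 0 := by
      refine tendsto_nhds_unique ((T.continuous.tendsto B).comp hB) ?_
      have h1 := ((tendsto_inv_atTop_zero.comp hbig).comp hσ).smul (hlimφ.comp hσ)
      rw [zero_smul] at h1
      refine h1.congr' ?_
      filter_upwards [(hcφ.comp hσ).eventually_gt_atTop 0] with n hn
      simp only [Function.comp] at hn ⊢
      rw [norm_smul, Real.norm_of_nonneg hn.le, smul_smul, mul_inv_rev, inv_mul_cancel_right₀ hn.ne',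
        map_smul, map_sub]
    have hTh : ∀ t : ℝ, T (exp (t • B)) = T 1 := fun t =>
      map_exp_eq_map_one hT (by rw [map_smul, hTB, smul_zero])
    -- Multiplication by exp(-r_n B) stays in the fibre, so minimality forbids coming closer to 1.
    -- But to first order this factor cancels d_n - 1, leaving distance o(r_n).
    have hle : ∀ n, r n ≤ ‖d (σ n) * exp (-r n • B) - 1‖ := fun n => by
      refine (hd (σ n)).2.2 _ (mul_mem (hd _).1 (hBmem _)) ?_
      have := hT (d (σ n)) (exp (-r n • B) - 1) (by rw [map_sub, hTh, sub_self])
      rwa [mul_sub, map_sub, mul_one, sub_eq_zero] at this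
    have hrB : Tendsto (fun n => -r n • B) atTop (𝓝 0) := by
      simpa using hr0.neg.smul_const B
    have hexp1 : Tendsto (fun n => exp (-r n • B)) atTop (𝓝 1) := by
      have := ((contDiff_normedSpace_exp (A := A) (n := 0)).continuous.tendsto 0).comp hrB
      rwa [exp_zero] at this
    have hexp2 : Tendsto (fun n => (r n)⁻¹ • (exp (-r n • B) - 1)) atTop (𝓝 (-B)) := by
      have hv : Tendsto (fun n => (r n)⁻¹ • -r n • B) atTop (𝓝 (-B)) := by
        refine tendsto_const_nhds.congr fun n => ?_
        rw [neg_smul, smul_neg, smul_smul, inv_mul_cancel₀ (hrpos n).ne', one_smul]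
      have := hasStrictFDerivAt_normedSpace_exp (A := A) |>.hasFDerivAt.hasFDerivWithinAt
        (s := univ) |>.lim hrB (by simp) hv
      simpa using this
    have hz : Tendsto (fun n => (r n)⁻¹ • (d (σ n) * exp (-r n • B) - 1)) atTop (𝓝 0) := by
      have := (hB.mul hexp1).add hexp2
      rw [mul_one, add_neg_cancel] at this
      refine this.congr fun n => ?_
      rw [smul_mul_assoc, ← smul_add, sub_mul, one_mul, sub_add_sub_cancel]
    have h1 : (1 : ℝ) ≤ 0 := by
      refine ge_of_tendsto (by simpa using hz.norm) (Eventually.of_forall fun n => ?_)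
      rw [norm_smul, norm_inv, Real.norm_of_nonneg (hrpos n).le, inv_mul_eq_div,
        le_div_iff₀ (hrpos n), one_mul]
      simpa using hle n
    exact absurd h1 (by norm_num)

end OrbitVelocity

/-! ### Charts of the isometry group. -/

section IsometryGroup

open Filter Topology NormedSpace

variable (X : Type*) [NormedAddCommGroup X] [NormedSpace ℝ X]

/-- The monoid of norm preserving linear endomorphisms. -/
def linIso : Submonoid (X →L[ℝ] X) where
  carrier := {a | ∀ x, ‖a x‖ = ‖x‖}
  one_mem' _ := rfl
  mul_mem' {_ b} ha hb x := (ha (b x)).trans (hb x)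

variable {X}

theorem mem_linIso {a : X →L[ℝ] X} : a ∈ linIso X ↔ ∀ x, ‖a x‖ = ‖x‖ := Iff.rfl

theorem isClosed_linIso : IsClosed (linIso X : Set (X →L[ℝ] X)) := by
  have : (linIso X : Set (X →L[ℝ] X)) = ⋂ x, {a : X →L[ℝ] X | ‖a x‖ = ‖x‖} := by
    ext a; simp [mem_linIso]
  rw [this]
  exact isClosed_iInter fun x => isClosed_eq (by fun_prop) continuous_const

variable (X) in
/-- The affine map `x ↦ a x + b`, as a function of the pair `(b, a)`. -/
noncomputable def affineOfPair : (X × (X →L[ℝ] X)) ≃L[ℝ] (X →ᴬ[ℝ] X) :=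
  (ContinuousAffineMap.decompLinearIsometryEquiv ℝ ℝ X X).symm.toContinuousLinearEquiv

@[simp]
theorem affineOfPair_apply (w : X × (X →L[ℝ] X)) (x : X) : affineOfPair X w x = w.2 x + w.1 := rfl

theorem affineOfPair_eta (h : X →ᴬ[ℝ] X) : affineOfPair X (h 0, h.contLinear) = h :=
  (affineOfPair X).apply_symm_apply h

theorem contLinear_apply_add (h : X →ᴬ[ℝ] X) (x : X) : h.contLinear x + h 0 = h x :=
  congrArg (fun f : X →ᴬ[ℝ] X => f x) (affineOfPair_eta h)

variable [FiniteDimensional ℝ X]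

theorem isCompact_linIso : IsCompact (linIso X : Set (X →L[ℝ] X)) := by
  have := FiniteDimensional.proper ℝ (X →L[ℝ] X)
  refine (isCompact_closedBall (0 : X →L[ℝ] X) 1).of_isClosed_subset isClosed_linIso fun a ha => ?_
  rw [mem_closedBall_zero_iff]
  exact a.opNorm_le_bound zero_le_one fun x => by rw [ha x, one_mul]

theorem exists_linearIsometryEquiv {a : X →L[ℝ] X} (ha : a ∈ linIso X) :
    ∃ f : X ≃ₗᵢ[ℝ] X, ∀ x, f x = a x :=
  ⟨LinearIsometry.toLinearIsometryEquiv ⟨a.toLinearMap, ha⟩ rfl, fun _ => rfl⟩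

theorem hasInverses_linIso : HasInverses (linIso X) := by
  intro a ha
  obtain ⟨f, hf⟩ := exists_linearIsometryEquiv ha
  refine ⟨f.symm.toContinuousLinearEquiv, fun x => f.symm.norm_map x, ?_, ?_⟩
  · ext x
    simp [← hf]
  · ext x
    simp [← hf]

theorem mem_isoSet_iff {h : X →ᴬ[ℝ] X} : h ∈ isoSet X ↔ h.contLinear ∈ linIso X := by
  constructor
  · rintro ⟨g, hg⟩ x
    rw [← add_sub_cancel_right (h.contLinear x) (h 0), contLinear_apply_add, hg, hg,
      ← dist_eq_norm, g.isometry.dist_eq, dist_zero_right]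
  · intro ha
    obtain ⟨f, hf⟩ := exists_linearIsometryEquiv ha
    exact ⟨f.toIsometryEquiv.trans (IsometryEquiv.addRight (h 0)), fun x => by
      simp only [IsometryEquiv.trans_apply, LinearIsometryEquiv.coe_toIsometryEquiv,
        IsometryEquiv.addRight_apply]
      rw [hf, contLinear_apply_add]⟩

theorem affineOfPair_mem_isoSet {w : X × (X →L[ℝ] X)} :
    affineOfPair X w ∈ isoSet X ↔ w.2 ∈ linIso X := by
  have : (affineOfPair X w).contLinear = w.2 :=
    ContinuousAffineMap.decompLinearIsometryEquiv_symm_contLinear ℝ ℝ X X w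
  rw [mem_isoSet_iff, this]

theorem isClosed_isoSet : IsClosed (isoSet X) := by
  have : isoSet X = (affineOfPair X).symm ⁻¹' (Prod.snd ⁻¹' (linIso X : Set (X →L[ℝ] X))) := by
    ext h; rw [mem_isoSet_iff]; rfl
  rw [this]
  exact (isClosed_linIso.preimage continuous_snd).preimage (affineOfPair X).symm.continuous

variable (X) in
/-- The Lie algebra of the group of linear isometries. -/
noncomputable abbrev linIsoLie : Submodule ℝ (X →L[ℝ] X) :=
  lieSubmodule (linIso X) isClosed_linIso hasInverses_linIso

/-- The parametrization of the isometry group near `h`. -/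
noncomputable def isoParam (h : X →ᴬ[ℝ] X) (w : X × linIsoLie X) : X →ᴬ[ℝ] X :=
  affineOfPair X (h 0 + w.1, h.contLinear * exp (w.2 : X →L[ℝ] X))

/-- The derivative of `isoParam h` at `0`. -/
noncomputable def isoParamDeriv (h : X →ᴬ[ℝ] X) : (X × linIsoLie X) →L[ℝ] (X →ᴬ[ℝ] X) :=
  ((affineOfPair X) : _ →L[ℝ] _).comp
    ((ContinuousLinearMap.fst ℝ _ _).prod
      ((ContinuousLinearMap.mul ℝ (X →L[ℝ] X) h.contLinear).comp
        ((linIsoLie X).subtypeL.comp (ContinuousLinearMap.snd ℝ _ _))))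

theorem isoParamDeriv_apply (h : X →ᴬ[ℝ] X) (w : X × linIsoLie X) :
    isoParamDeriv h w = affineOfPair X (w.1, h.contLinear * (w.2 : X →L[ℝ] X)) := rfl

theorem isoParam_zero (h : X →ᴬ[ℝ] X) : isoParam h 0 = h := by
  simp [isoParam, affineOfPair_eta]

theorem isoParam_mem {h : X →ᴬ[ℝ] X} (hh : h ∈ isoSet X) (w : X × linIsoLie X) :
    isoParam h w ∈ isoSet X :=
  affineOfPair_mem_isoSet.2 (mul_mem (mem_isoSet_iff.1 hh) (exp_mem_of_mem_lieSubmodule w.2.2))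

theorem contDiff_isoParam (h : X →ᴬ[ℝ] X) : ContDiff ℝ ω (isoParam h) := by
  refine (affineOfPair X).contDiff.comp ((contDiff_const.add contDiff_fst).prodMk
    (contDiff_const.mul ?_))
  exact contDiff_normedSpace_exp.comp ((linIsoLie X).subtypeL.contDiff.comp contDiff_snd)

theorem hasFDerivAt_isoParam (h : X →ᴬ[ℝ] X) :
    HasFDerivAt (isoParam h) (isoParamDeriv h) 0 := by
  have he : HasFDerivAt (exp : (X →L[ℝ] X) → _) (ContinuousLinearMap.id ℝ _) 0 :=
    hasStrictFDerivAt_normedSpace_exp.hasFDerivAt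
  have hl := ((linIsoLie X).subtypeL.comp
    (ContinuousLinearMap.snd ℝ X (linIsoLie X))).hasFDerivAt (x := 0)
  have h1 := HasFDerivAt.comp (g := (exp : (X →L[ℝ] X) → _)) 0 (by rwa [map_zero]) hl
  have h2 := (ContinuousLinearMap.mul ℝ (X →L[ℝ] X) h.contLinear).hasFDerivAt.comp 0 h1
  have h3 := (ContinuousLinearMap.fst ℝ X (linIsoLie X)).hasFDerivAt (x := 0) |>.const_add (h 0)
  exact (affineOfPair X).hasFDerivAt.comp 0 (h3.prodMk h2)

/-- Local charts of the isometry group. -/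
theorem exists_iso_chart {h : X →ᴬ[ℝ] X} (hh : h ∈ isoSet X) :
    ∃ (U : Set (X →ᴬ[ℝ] X)) (W : Set (X × linIsoLie X)) (ψ : (X →ᴬ[ℝ] X) → X × linIsoLie X),
      IsOpen U ∧ h ∈ U ∧ IsOpen W ∧ 0 ∈ W ∧ ContDiffOn ℝ ω ψ U ∧
      (∀ w ∈ W, isoParam h w ∈ U ∧ ψ (isoParam h w) = w) ∧
      ∀ k ∈ isoSet X, k ∈ U → ψ k ∈ W ∧ isoParam h (ψ k) = k := by
  obtain ⟨U, W, ψ, hU, h1U, hW, h0W, hψ, hl, hr⟩ :=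
    exists_exp_chart (isClosed_linIso (X := X)) hasInverses_linIso
  obtain ⟨a', ha', haa', ha'a⟩ := hasInverses_linIso _ (mem_isoSet_iff.1 hh)
  let f : (X →ᴬ[ℝ] X) → (X →L[ℝ] X) := fun k => a' * k.contLinear
  have hcl : ContDiff ℝ ω fun k : X →ᴬ[ℝ] X => k.contLinear :=
    contDiff_snd.comp (affineOfPair X).symm.contDiff
  have h0 : ContDiff ℝ ω fun k : X →ᴬ[ℝ] X => k 0 :=
    contDiff_fst.comp (affineOfPair X).symm.contDiff
  have hf : ContDiff ℝ ω f := contDiff_const.mul hcl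
  have hfp : ∀ w, f (isoParam h w) = exp (w.2 : X →L[ℝ] X) := fun w => by
    have : (isoParam h w).contLinear = h.contLinear * exp (w.2 : X →L[ℝ] X) :=
      ContinuousAffineMap.decompLinearIsometryEquiv_symm_contLinear ℝ ℝ X X _
    simp only [f]
    rw [this, ← mul_assoc, ha'a, one_mul]
  have hp0 : ∀ w, isoParam h w 0 = h 0 + w.1 := fun w => by simp [isoParam]
  refine ⟨f ⁻¹' U, Prod.snd ⁻¹' W, fun k => (k 0 - h 0, ψ (f k)), hU.preimage hf.continuous,
    by simpa [f, ha'a] using h1U, hW.preimage continuous_snd, h0W,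
    (h0.sub contDiff_const).contDiffOn.prodMk (hψ.comp hf.contDiffOn fun _ hk => hk), ?_, ?_⟩
  · intro w hw
    refine ⟨by rw [mem_preimage, hfp]; exact (hl _ hw).1, ?_⟩
    change (isoParam h w 0 - h 0, ψ (f (isoParam h w))) = w
    rw [hfp, hp0, (hl _ hw).2, add_sub_cancel_left]
  · intro k hk hkU
    obtain ⟨h1, h2⟩ := hr (f k) (mul_mem ha' (mem_isoSet_iff.1 hk)) hkU
    refine ⟨h1, ?_⟩
    rw [isoParam, h2, add_sub_cancel]
    simp only [f]
    rw [← mul_assoc, haa', one_mul, affineOfPair_eta]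

end IsometryGroup

/-! ### Trivial motions as the image of the Lie algebra. -/

section TrivialMotions

open Filter Topology NormedSpace

variable {X : Type*} [NormedAddCommGroup X] [NormedSpace ℝ X] {S : Type*}

theorem affineAct_apply (p : S → X) (h : X →ᴬ[ℝ] X) (v : S) : affineAct p h v = h (p v) := rfl

theorem mem_orbitSet_iff {p x : S → X} :
    x ∈ orbitSet p ↔ ∃ h ∈ isoSet X, affineAct p h = x := by
  constructor
  · rintro ⟨g, hg⟩
    obtain ⟨h, hh, hhg⟩ := exists_mem_isoSet g
    exact ⟨h, hh, funext fun v => (hhg _).trans (hg v).symm⟩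
  · rintro ⟨h, ⟨g, hg⟩, rfl⟩
    exact ⟨g, fun v => hg _⟩

variable [FiniteDimensional ℝ X]

/-- The infinitesimal action of the Lie algebra of the isometry group on a placement. -/
noncomputable def tangentAct (p : S → X) : (X × linIsoLie X) →ₗ[ℝ] (S → X) :=
  (affineAct p).comp (isoParamDeriv (ContinuousAffineMap.id ℝ X)).toLinearMap

theorem tangentAct_apply (p : S → X) (w : X × linIsoLie X) (v : S) :
    tangentAct p w v = (w.2 : X →L[ℝ] X) (p v) + w.1 := by
  have : (ContinuousAffineMap.id ℝ X).contLinear = 1 := by ext; rfl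
  simp [tangentAct, isoParamDeriv_apply, affineAct_apply, this]

theorem tangentAct_mem_trivialMotions (p : S → X) (w : X × linIsoLie X) :
    tangentAct p w ∈ trivialMotions p := by
  have hd : ∀ v, ∀ t : ℝ, HasDerivAt
      (fun t : ℝ => exp (t • (w.2 : X →L[ℝ] X)) (p v) + t • w.1)
      ((exp (t • (w.2 : X →L[ℝ] X)) * (w.2 : X →L[ℝ] X)) (p v) + w.1) t := fun v t => by
    have h1 := (hasDerivAt_exp_smul_const (𝕂 := ℝ) (w.2 : X →L[ℝ] X) t).clm_apply
      (hasDerivAt_const t (p v))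
    have h2 := (hasDerivAt_id t).smul_const w.1
    simpa using! h1.fun_add h2
  refine ⟨1, one_pos, fun v t => exp (t • (w.2 : X →L[ℝ] X)) (p v) + t • w.1,
    fun v t _ => (hd v t).continuousAt.continuousWithinAt, fun v => by simp, fun t _ => ?_,
    fun v => ?_⟩
  · exact mem_orbitSet_iff.2 ⟨affineOfPair X (t • w.1, exp (t • (w.2 : X →L[ℝ] X))),
      affineOfPair_mem_isoSet.2 (w.2.2 t), rfl⟩
  · simpa [tangentAct_apply] using hd v 0

theorem mem_range_tangentAct [Nonempty S] {p u : S → X} (hu : u ∈ trivialMotions p) :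
    u ∈ LinearMap.range (tangentAct p) := by
  obtain ⟨δ, hδ, α, -, h0, hO, hd⟩ := hu
  obtain ⟨v₀⟩ := ‹Nonempty S›
  -- The shift by 2 keeps the times strictly below δ, including at n = 0.
  have hex : ∀ n : ℕ, ∃ h ∈ isoSet X, ∀ v, h (p v) = α v (δ / (n + 2)) := fun n => by
    have hn : (0 : ℝ) < n + 2 := by positivity
    have : δ / (n + 2) ∈ Ioo (-δ) δ :=
      ⟨(neg_neg_of_pos hδ).trans (by positivity), div_lt_self hδ (by linarith [n.cast_nonneg (α := ℝ)])⟩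
    obtain ⟨h, hh, e⟩ := mem_orbitSet_iff.1 (hO _ this)
    exact ⟨h, hh, fun v => congrFun e v⟩
  choose h hh hα using hex
  -- Positions relative to a base vertex v₀ see only the linear part, which reduces the problem to
  -- the compact group `linIso X`.
  have hlin : ∀ n v, (h n).contLinear (p v - p v₀) = α v (δ / (n + 2)) - α v₀ (δ / (n + 2)) :=
    fun n v => by
      rw [← hα, ← hα, ← contLinear_apply_add _ (p v), ← contLinear_apply_add _ (p v₀), map_sub]
      abel
  let T : (X →L[ℝ] X) →L[ℝ] (S → X) :=
    ContinuousLinearMap.pi fun v => ContinuousLinearMap.apply ℝ X (p v - p v₀)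
  have hT : ∀ a v, T a v = a (p v - p v₀) := fun _ _ => rfl
  have hc : Tendsto (fun n : ℕ => (δ / (n + 2))⁻¹) atTop atTop := by
    simp only [inv_div]
    exact (tendsto_atTop_add_const_right _ _ tendsto_natCast_atTop_atTop).atTop_div_const hδ
  have hlim : Tendsto (fun n : ℕ => (δ / (n + 2))⁻¹ • (T (h n).contLinear - T 1)) atTop
      (𝓝 fun v => u v - u v₀) := by
    refine tendsto_pi_nhds.2 fun v => ?_
    have hdv := ((hd v).sub (hd v₀)).hasFDerivAt.lim_real 1
    refine (hdv.comp hc).congr' ?_ |>.trans (by simp)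
    refine Eventually.of_forall fun n => ?_
    simp [hT, hlin, h0]
  obtain ⟨B, hB, hBu⟩ := exists_mem_lieSubmodule_of_tendsto isCompact_linIso
    (hasInverses_linIso (X := X)) (T := T)
    (fun c a ha => funext fun v => by
      have : a (p v - p v₀) = 0 := congrFun ha v
      change c (a (p v - p v₀)) = 0
      rw [this, map_zero])
    (fun n => mem_isoSet_iff.1 (hh n)) hc hlim
  -- B accounts for the velocities relative to v₀; the translation part is fixed by matching the
  -- velocity at v₀ itself.
  refine ⟨(u v₀ - B (p v₀), ⟨B, hB⟩), funext fun v => ?_⟩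
  have := congrFun hBu v
  rw [hT, map_sub] at this
  rw [tangentAct_apply, ← sub_add_cancel (u v) (u v₀), ← this]
  simp only
  abel

theorem coe_range_tangentAct [Nonempty S] (p : S → X) :
    (LinearMap.range (tangentAct p) : Set (S → X)) = trivialMotions p := by
  refine Subset.antisymm ?_ fun u hu => mem_range_tangentAct hu
  rintro _ ⟨w, rfl⟩
  exact tangentAct_mem_trivialMotions p w

/-- Translations suffice: the pair (x, 0) gives every vertex velocity x, and one vertex recovers x.
-/
theorem finrank_le_finrank_range_tangentAct [Nonempty S] (p : S → X) :
    finrank ℝ X ≤ finrank ℝ (LinearMap.range (tangentAct p)) := by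
  obtain ⟨v₀⟩ := ‹Nonempty S›
  refine LinearMap.finrank_le_finrank_of_injective
    (f := (tangentAct p).rangeRestrict.comp (LinearMap.inl ℝ X (linIsoLie X))) fun x y hxy => ?_
  have := congrFun (congrArg Subtype.val hxy) v₀
  simpa [tangentAct_apply] using this

theorem finrank_range_tangentAct_eq_iff (p : S → X) :
    finrank ℝ (LinearMap.range (tangentAct p)) = finrank ℝ (X × linIsoLie X) ↔
      Function.Injective (tangentAct p) := by
  rw [← (tangentAct p).finrank_range_add_finrank_ker, ← LinearMap.ker_eq_bot,
    ← Submodule.finrank_eq_zero (R := ℝ)]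
  omega

end TrivialMotions

/-! ### Coordinate independence and invariance of dimension. -/

section SmoothSubsets

open Filter Topology

section

variable {E F : Type*} [NormedAddCommGroup E] [NormedSpace ℝ E] [NormedAddCommGroup F]
  [NormedSpace ℝ F]

/-- Differentiable maps between open neighbourhoods which are mutually inverse relate spaces of the
same dimension. -/
theorem finrank_eq_of_eventually_inverse {f : E → F} {g : F → E} {x : E} {y : F} (hxy : f x = y)
    (hyx : g y = x) (hf : DifferentiableAt ℝ f x) (hg : DifferentiableAt ℝ g y)
    (hgf : ∀ᶠ z in 𝓝 x, g (f z) = z) (hfg : ∀ᶠ z in 𝓝 y, f (g z) = z) :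
    finrank ℝ E = finrank ℝ F := by
  subst hxy
  have h1 : (fderiv ℝ g (f x)).comp (fderiv ℝ f x) = ContinuousLinearMap.id ℝ E :=
    ((hg.hasFDerivAt.comp x hf.hasFDerivAt).congr_of_eventuallyEq
      (hgf.mono fun z hz => hz.symm)).unique (hasFDerivAt_id x)
  have h2 : (fderiv ℝ f x).comp (fderiv ℝ g (f x)) = ContinuousLinearMap.id ℝ F := by
    have hf' : HasFDerivAt f (fderiv ℝ f x) (g (f x)) := by rw [hyx]; exact hf.hasFDerivAt
    exact ((hf'.comp (f x) hg.hasFDerivAt).congr_of_eventuallyEq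
      (hfg.mono fun z hz => hz.symm)).unique (hasFDerivAt_id _)
  exact (ContinuousLinearEquiv.equivOfInverse' _ _ h2 h1).toLinearEquiv.finrank_eq

end

section

variable {E : Type*} [AddCommGroup E] [Module ℝ E] [TopologicalSpace E] [IsTopologicalAddGroup E]
  [ContinuousSMul ℝ E] [T2Space E] [FiniteDimensional ℝ E]
  {F : Type*} [AddCommGroup F] [Module ℝ F] [TopologicalSpace F] [IsTopologicalAddGroup F]
  [ContinuousSMul ℝ F] [T2Space F] [FiniteDimensional ℝ F]
  {E' : Type*} [NormedAddCommGroup E'] [NormedSpace ℝ E']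
  {F' : Type*} [NormedAddCommGroup F'] [NormedSpace ℝ F']

/-- Smoothness may be tested in any linear coordinates. -/
theorem smoothOnOpen_iff (e : E ≃L[ℝ] E') (e' : F ≃L[ℝ] F') {f : E → F} {U : Set E} :
    SmoothOnOpen f U ↔
      IsOpen U ∧ ContDiffOn ℝ ∞ (fun x => e' (f (e.symm x))) (e '' U) := by
  refine and_congr_right fun _ => ?_
  constructor
  · intro h
    have h1 := h.comp (e.symm.trans toEuclidean).contDiff.contDiffOn (s := e '' U) (by
      rintro _ ⟨x, hx, rfl⟩
      exact ⟨x, hx, by simp⟩)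
    have h2 := (toEuclidean.symm.trans e' : _ ≃L[ℝ] F').contDiff.comp_contDiffOn h1
    simpa [Function.comp_def] using h2
  · intro h
    have h1 := h.comp (toEuclidean.symm.trans e : _ ≃L[ℝ] E').contDiff.contDiffOn
      (s := (toEuclidean : E ≃L[ℝ] _) '' U) (by
      rintro _ ⟨x, hx, rfl⟩
      exact ⟨x, hx, by simp⟩)
    have h2 := (e'.symm.trans toEuclidean).contDiff.comp_contDiffOn h1
    simpa [Function.comp_def] using h2

/-- A smooth map on a subset extends differentiably near each point. -/
theorem SmoothOnSubset.exists_differentiableAt (e : E ≃L[ℝ] E') (e' : F ≃L[ℝ] F') {f : E → F}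
    {M : Set E} (hf : SmoothOnSubset f M) {x : E} (hx : x ∈ M) :
    ∃ g : E → F, DifferentiableAt ℝ (fun z => e' (g (e.symm z))) (e x) ∧
      ∀ᶠ y in 𝓝 x, y ∈ M → f y = g y := by
  obtain ⟨U, hxU, g, hg, hfg⟩ := hf x hx
  obtain ⟨hU, hg⟩ := (smoothOnOpen_iff e e').1 hg
  have hU' : IsOpen (e '' U) := e.toHomeomorph.isOpenMap U hU
  refine ⟨g, (hg.contDiffAt (hU'.mem_nhds ⟨x, hxU, rfl⟩)).differentiableAt (by simp), ?_⟩
  filter_upwards [hU.mem_nhds hxU] with y hy hyM using hfg ⟨hyM, hy⟩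

end

variable {E F : Type*} [NormedAddCommGroup E] [NormedSpace ℝ E] [FiniteDimensional ℝ E]
  [NormedAddCommGroup F] [NormedSpace ℝ F] [FiniteDimensional ℝ F]

theorem SmoothOnOpen.of_contDiffOn {f : E → F} {U : Set E} (hU : IsOpen U)
    (hf : ContDiffOn ℝ ∞ f U) : SmoothOnOpen f U :=
  (smoothOnOpen_iff (ContinuousLinearEquiv.refl ℝ E) (ContinuousLinearEquiv.refl ℝ F)).2
    ⟨hU, by simpa using hf⟩

theorem SmoothOnSubset.of_contDiffOn {f : E → F} {M U : Set E} (hU : IsOpen U) (hM : M ⊆ U)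
    (hf : ContDiffOn ℝ ∞ f U) : SmoothOnSubset f M :=
  fun _ hx => ⟨U, hM hx, f, SmoothOnOpen.of_contDiffOn hU hf, fun _ _ => rfl⟩

theorem SmoothOnSubset.exists_differentiableAt_normed {f : E → F}
    {M : Set E} (hf : SmoothOnSubset f M) {x : E} (hx : x ∈ M) :
    ∃ g : E → F, DifferentiableAt ℝ g x ∧ ∀ᶠ y in 𝓝 x, y ∈ M → f y = g y := by
  simpa using hf.exists_differentiableAt (ContinuousLinearEquiv.refl ℝ E)
    (ContinuousLinearEquiv.refl ℝ F) hx

end SmoothSubsets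

/-! ### The isometry group as a manifold of unique dimension. -/

section IsometryManifold

open Filter Topology

variable {X : Type*} [NormedAddCommGroup X] [NormedSpace ℝ X]

theorem id_mem_isoSet : ContinuousAffineMap.id ℝ X ∈ isoSet X :=
  ⟨IsometryEquiv.refl X, fun _ => rfl⟩

variable [FiniteDimensional ℝ X]

theorem isSmoothManifoldOfDim_isoSet :
    IsSmoothManifoldOfDim (isoSet X) (finrank ℝ (X × linIsoLie X)) := by
  intro h hh
  obtain ⟨U, W, ψ, hU, hhU, hW, -, hψ, hl, hr⟩ := exists_iso_chart hh
  let e : (X × linIsoLie X) ≃L[ℝ] EuclideanSpace ℝ (Fin (finrank ℝ (X × linIsoLie X))) :=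
    toEuclidean
  have hW' : IsOpen (e.symm ⁻¹' W) := hW.preimage e.symm.continuous
  refine ⟨U, e.symm ⁻¹' W, hU, hW', hhU, fun k => e (ψ k), ?_, ?_,
    fun z => isoParam h (e.symm z), ?_, ?_, ?_, ?_⟩
  · rintro k ⟨hk, hkU⟩
    simpa using (hr k hk hkU).1
  · exact SmoothOnSubset.of_contDiffOn hU inter_subset_right
      (e.contDiff.comp_contDiffOn (hψ.of_le le_top))
  · exact fun z hz => ⟨isoParam_mem hh _, (hl _ hz).1⟩
  · exact SmoothOnSubset.of_contDiffOn isOpen_univ (subset_univ _)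
      (((contDiff_isoParam h).of_le le_top).comp e.symm.contDiff).contDiffOn
  · rintro k ⟨hk, hkU⟩
    simpa using (hr k hk hkU).2
  · intro z hz
    simp [(hl _ hz).2]

theorem eq_finrank_of_isSmoothManifoldOfDim_isoSet {k : ℕ}
    (hk : IsSmoothManifoldOfDim (isoSet X) k) : k = finrank ℝ (X × linIsoLie X) := by
  set i := ContinuousAffineMap.id ℝ X
  have hi : i ∈ isoSet X := id_mem_isoSet
  obtain ⟨U, W, ψ, hU, hiU, hW, h0W, hψ, hl, hr⟩ := exists_iso_chart hi
  obtain ⟨U', W', hU', hW', hiU', f, hfm, hfs, g, hgm, hgs, hgf, hfg⟩ := hk i hi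
  have hfi : f i ∈ W' := hfm ⟨hi, hiU'⟩
  -- The charts are smooth only as maps on subsets; ambient extensions, differentiable at the base
  -- point, allow the chain rule to be applied to the change of charts.
  obtain ⟨f₁, hf₁, hff₁⟩ := hfs.exists_differentiableAt_normed ⟨hi, hiU'⟩
  obtain ⟨g₁, hg₁, hgg₁⟩ := hgs.exists_differentiableAt_normed hfi
  have hgi : g (f i) = i := hgf ⟨hi, hiU'⟩
  have hgi₁ : g₁ (f i) = i := (hgg₁.self_of_nhds hfi).symm.trans hgi
  have hfi₁ : f₁ i = f i := (hff₁.self_of_nhds ⟨hi, hiU'⟩).symm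
  have hp0 : isoParam i 0 = i := isoParam_zero i
  have hψi : ψ i = 0 := by
    have := (hl 0 h0W).2
    rwa [hp0] at this
  have hpc : Tendsto (isoParam i) (𝓝 0) (𝓝 i) := by
    have := (contDiff_isoParam i).continuous.tendsto 0
    rwa [hp0] at this
  have hg₁c : Tendsto g₁ (𝓝 (f i)) (𝓝 i) := by
    have := hg₁.continuousAt.tendsto
    rwa [hgi₁] at this
  have hf₁c : Tendsto f₁ (𝓝 i) (𝓝 (f i)) := by
    have := hf₁.continuousAt.tendsto
    rwa [hfi₁] at this
  have key : finrank ℝ (X × linIsoLie X) = finrank ℝ (EuclideanSpace ℝ (Fin k)) := by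
    refine finrank_eq_of_eventually_inverse (f := f₁ ∘ isoParam i) (g := ψ ∘ g₁) (x := 0)
      (y := f i) (by simp [hp0, hfi₁]) (by simp [hgi₁, hψi]) ?_ ?_ ?_ ?_
    · refine DifferentiableAt.comp 0 (by rwa [hp0]) (hasFDerivAt_isoParam i).differentiableAt
    · refine DifferentiableAt.comp (f i) ?_ hg₁
      rw [hgi₁]
      exact (hψ.contDiffAt (hU.mem_nhds hiU)).differentiableAt (by simp)
    · filter_upwards [hpc.eventually (hU'.mem_nhds hiU'), hpc.eventually hff₁,
        (hf₁c.comp hpc).eventually hgg₁, hW.mem_nhds h0W] with w h1 h2 h3 h4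
      have hm : isoParam i w ∈ isoSet X ∩ U' := ⟨isoParam_mem hi w, h1⟩
      have h5 := h2 hm
      have h6 := h3 (by simp only [Function.comp, ← h5]; exact hfm hm)
      simp only [Function.comp] at h6 ⊢
      rw [← h6, ← h5, hgf hm, (hl w h4).2]
    · filter_upwards [hW'.mem_nhds hfi, hgg₁, hg₁c.eventually (hU.mem_nhds hiU),
        hg₁c.eventually hff₁] with z h1 h2 h3 h4
      have h5 := h2 h1
      have hm := hgm h1
      rw [h5] at hm
      simp only [Function.comp]
      rw [(hr _ hm.1 h3).2, ← h4 hm, ← h5, hfg h1]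
  simpa using key.symm

end IsometryManifold

/-! ### Fullness and injectivity of the infinitesimal action. -/

section Full

open Filter Topology NormedSpace

variable {X : Type*} [NormedAddCommGroup X] [NormedSpace ℝ X] {S : Type*}

theorem comp_mem_isoSet {h k : X →ᴬ[ℝ] X} (hh : h ∈ isoSet X) (hk : k ∈ isoSet X) :
    h.comp k ∈ isoSet X := by
  obtain ⟨f, hf⟩ := hh
  obtain ⟨g, hg⟩ := hk
  exact ⟨g.trans f, fun x => by simp [hf, hg]⟩

theorem exists_inverse_mem_isoSet {h : X →ᴬ[ℝ] X} (hh : h ∈ isoSet X) :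
    ∃ k ∈ isoSet X, (∀ x, k (h x) = x) ∧ ∀ x, h (k x) = x := by
  obtain ⟨f, hf⟩ := hh
  obtain ⟨k, hk, hkf⟩ := exists_mem_isoSet f.symm
  exact ⟨k, hk, fun x => by simp [hf, hkf], fun x => by simp [hf, hkf]⟩

theorem continuous_comp_right (k : X →ᴬ[ℝ] X) :
    Continuous fun h : X →ᴬ[ℝ] X => h.comp k := by
  have h1 : (fun h : X →ᴬ[ℝ] X => h.comp k) = fun h =>
      affineOfPair X (h.contLinear (k 0) + h 0, h.contLinear.comp k.contLinear) := by
    ext h x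
    change h (k x) = h.contLinear (k.contLinear x) + (h.contLinear (k 0) + h 0)
    rw [← add_assoc, ← map_add, contLinear_apply_add, contLinear_apply_add]
  have h2 : Continuous fun h : X →ᴬ[ℝ] X => (h 0, h.contLinear) :=
    (affineOfPair X).symm.continuous
  have h3 : Continuous fun h : X →ᴬ[ℝ] X => h.contLinear := h2.snd
  rw [h1]
  exact (affineOfPair X).continuous.comp
    (((h3.clm_apply continuous_const).add h2.fst).prodMk (h3.clm_comp continuous_const))

variable [FiniteDimensional ℝ X]

/-- The orbit map `h ↦ h.p` on affine maps. -/
noncomputable def orbitMap (p : S → X) : (X →ᴬ[ℝ] X) →L[ℝ] affineOrbit p :=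
  (affineAct p).rangeRestrict.toContinuousLinearMap

theorem coe_orbitMap (p : S → X) (h : X →ᴬ[ℝ] X) (v : S) :
    (orbitMap p h : S → X) v = h (p v) := rfl

theorem orbitMap_eq_iff {p : S → X} {h k : X →ᴬ[ℝ] X} :
    orbitMap p h = orbitMap p k ↔ ∀ v, h (p v) = k (p v) := by
  rw [Subtype.ext_iff, funext_iff]
  rfl

theorem orbitMap_mem {p : S → X} {h : X →ᴬ[ℝ] X} (hh : h ∈ isoSet X) :
    orbitMap p h ∈ (Subtype.val ⁻¹' orbitSet p : Set (affineOrbit p)) :=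
  mem_orbitSet_iff.2 ⟨h, hh, rfl⟩

theorem exists_of_mem_orbitSet {p : S → X} {y : affineOrbit p}
    (hy : y ∈ (Subtype.val ⁻¹' orbitSet p : Set (affineOrbit p))) :
    ∃ h ∈ isoSet X, orbitMap p h = y := by
  obtain ⟨h, hh, e⟩ := mem_orbitSet_iff.1 hy
  exact ⟨h, hh, Subtype.ext e⟩

/-- An isometry is determined by its linear part and its value at one vertex. The image is thus the
projection of a closed set along the compact factor `linIso X`. -/
theorem isClosed_orbitMap_image [Nonempty S] (p : S → X) {C : Set (X →ᴬ[ℝ] X)} (hC : IsClosed C)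
    (hCi : C ⊆ isoSet X) : IsClosed (orbitMap p '' C) := by
  obtain ⟨v₀⟩ := ‹Nonempty S›
  have : CompactSpace (linIso X) := isCompact_iff_compactSpace.1 isCompact_linIso
  let f : linIso X × affineOrbit p → (X →ᴬ[ℝ] X) := fun z =>
    affineOfPair X ((z.2 : S → X) v₀ - (z.1 : X →L[ℝ] X) (p v₀), z.1)
  have hf : Continuous f := by
    refine (affineOfPair X).continuous.comp (Continuous.prodMk ?_ (by fun_prop))
    exact ((continuous_apply v₀).comp (continuous_subtype_val.comp continuous_snd)).sub
      ((continuous_subtype_val.comp continuous_fst).clm_apply continuous_const)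
  have hD : IsClosed {z | f z ∈ C ∧ orbitMap p (f z) = z.2} :=
    (hC.preimage hf).inter (isClosed_eq ((orbitMap p).continuous.comp hf) continuous_snd)
  convert isClosedMap_snd_of_compactSpace _ hD using 1
  ext y
  constructor
  · rintro ⟨h, hh, rfl⟩
    have hfh : f (⟨h.contLinear, mem_isoSet_iff.1 (hCi hh)⟩, orbitMap p h) = h := by
      simp only [f]
      rw [coe_orbitMap, ← contLinear_apply_add, add_sub_cancel_left, affineOfPair_eta]
    exact ⟨(⟨h.contLinear, mem_isoSet_iff.1 (hCi hh)⟩, orbitMap p h),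
      ⟨by rwa [hfh], by rw [hfh]⟩, rfl⟩
  · rintro ⟨z, ⟨hz1, hz2⟩, rfl⟩
    exact ⟨f z, hz1, hz2⟩

/-- The orbit map is open onto the orbit. -/
theorem exists_isOpen_orbitMap_image [Nonempty S] (p : S → X) {U : Set (X →ᴬ[ℝ] X)}
    (hU : IsOpen U) : ∃ V : Set (affineOrbit p), IsOpen V ∧
      Subtype.val ⁻¹' orbitSet p ∩ V = orbitMap p '' (isoSet X ∩ U) := by
  -- These are the isometries h whose whole coset h·Stab(p) avoids U, an intersection of closed
  -- conditions indexed by the stabilizer. The complement of their image is the open set sought.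
  have hC : IsClosed {h | h ∈ isoSet X ∧ orbitMap p h ∉ orbitMap p '' (isoSet X ∩ U)} := by
    have : {h | h ∈ isoSet X ∧ orbitMap p h ∉ orbitMap p '' (isoSet X ∩ U)} =
        isoSet X ∩ ⋂ k ∈ {k | k ∈ isoSet X ∧ ∀ v, k (p v) = p v},
          (fun h : X →ᴬ[ℝ] X => h.comp k) ⁻¹' Uᶜ := by
      ext h
      simp only [mem_inter_iff, mem_iInter, mem_preimage, mem_ofPred_eq, mem_compl_iff]
      refine and_congr_right fun hh => ⟨?_, ?_⟩
      · rintro hn k ⟨hk, hkp⟩ hU'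
        exact hn ⟨h.comp k, ⟨comp_mem_isoSet hh hk, hU'⟩,
          orbitMap_eq_iff.2 fun v => by simp [hkp]⟩
      · rintro hn ⟨h', ⟨hh', hU'⟩, he⟩
        obtain ⟨k, hk, hkh, hhk⟩ := exists_inverse_mem_isoSet hh
        refine hn (k.comp h') ⟨comp_mem_isoSet hk hh', fun v => ?_⟩ ?_
        · simp [orbitMap_eq_iff.1 he, hkh]
        · convert hU'
          ext x
          simp [hhk]
    rw [this]
    exact isClosed_isoSet.inter (isClosed_biInter fun k _ =>
      hU.isClosed_compl.preimage (continuous_comp_right k))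
  refine ⟨_, (isClosed_orbitMap_image p hC fun h hh => hh.1).isOpen_compl, ?_⟩
  ext y
  constructor
  · rintro ⟨hy, hyC⟩
    obtain ⟨h, hh, rfl⟩ := exists_of_mem_orbitSet hy
    by_contra hn
    exact hyC ⟨h, ⟨hh, hn⟩, rfl⟩
  · rintro ⟨h, ⟨hh, hhU⟩, rfl⟩
    refine ⟨orbitMap_mem hh, ?_⟩
    rintro ⟨h', ⟨-, hn⟩, he⟩
    exact hn ⟨h, ⟨hh, hhU⟩, he.symm⟩

/-- Undoing the linear part of h carries the derivative at h to the one at the identity, so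
injectivity there gives it at every isometry. -/
theorem orbitMap_isoParamDeriv_injective {p : S → X} (hp : Function.Injective (tangentAct p))
    {h : X →ᴬ[ℝ] X} (hh : h ∈ isoSet X) :
    Function.Injective fun w => orbitMap p (isoParamDeriv h w) := by
  obtain ⟨a', -, haa', ha'a⟩ := hasInverses_linIso _ (mem_isoSet_iff.1 hh)
  have hl : ∀ x, a' (h.contLinear x) = x := fun x => congrArg (fun f : X →L[ℝ] X => f x) ha'a
  have hr : ∀ x, h.contLinear (a' x) = x := fun x => congrArg (fun f : X →L[ℝ] X => f x) haa'
  have key : ∀ w v, a' ((orbitMap p (isoParamDeriv h w) : S → X) v) =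
      tangentAct p (a' w.1, w.2) v := fun w v => by
    rw [coe_orbitMap, isoParamDeriv_apply, affineOfPair_apply, tangentAct_apply, map_add]
    exact congrArg (· + a' w.1) (hl _)
  intro w z hwz
  have h1 : tangentAct p (a' w.1, w.2) = tangentAct p (a' z.1, z.2) := funext fun v => by
    rw [← key, ← key]
    exact congrArg (fun y : affineOrbit p => a' ((y : S → X) v)) hwz
  have h2 := Prod.ext_iff.1 (hp h1)
  refine Prod.ext ?_ h2.2
  rw [← hr w.1, ← hr z.1]
  exact congrArg _ h2.1

theorem isFull_of_injective [Nonempty S] {p : S → X} (hp : Function.Injective (tangentAct p)) :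
    IsFull p := by
  refine ⟨fun h hh => orbitMap_mem hh, fun h hh => ?_⟩
  obtain ⟨U, W, ψ, hU, hhU, hW, h0W, hψ, hl, hr⟩ := exists_iso_chart hh
  let D : (X × linIsoLie X) →ₗ[ℝ] affineOrbit p := ((orbitMap p).comp (isoParamDeriv h)).toLinearMap
  -- A linear left inverse P of the derivative turns the orbit map in the chart into a self-map of X
  -- × L with derivative 1 at 0. Its local inverse Φ⁻¹ gives the smooth candidate y ↦ `isoParam h`
  -- (Φ⁻¹ (P y)), defined on an open subset of A_p.
  obtain ⟨P₀, hP₀⟩ := D.exists_leftInverse_of_injective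
    (LinearMap.ker_eq_bot.2 (orbitMap_isoParamDeriv_injective hp hh))
  let P : affineOrbit p →L[ℝ] (X × linIsoLie X) := P₀.toContinuousLinearMap
  let Q : (X →ᴬ[ℝ] X) →L[ℝ] (X × linIsoLie X) := P.comp (orbitMap p)
  have hf' : HasFDerivAt (fun w => Q (isoParam h w))
      (ContinuousLinearEquiv.refl ℝ (X × linIsoLie X) : X × linIsoLie X →L[ℝ] X × linIsoLie X) 0 := by
    have := Q.hasFDerivAt.comp 0 (hasFDerivAt_isoParam h)
    have e : Q.comp (isoParamDeriv h) =
        (ContinuousLinearEquiv.refl ℝ (X × linIsoLie X) : X × linIsoLie X →L[ℝ] _) :=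
      ContinuousLinearMap.ext fun w => LinearMap.congr_fun hP₀ w
    rwa [e] at this
  obtain ⟨Φ, hΦ, h0Φ, hθ⟩ := exists_openPartialHomeomorph_contDiffOn_symm
    (Q.contDiff.comp (contDiff_isoParam h)) hf'
  have hΦ' : ∀ w, Φ w = Q (isoParam h w) := fun w => by rw [hΦ]; rfl
  have hU₀ : IsOpen (U ∩ ψ ⁻¹' (W ∩ Φ.source)) :=
    hψ.continuousOn.isOpen_inter_preimage hU (hW.inter Φ.open_source)
  have hθP : ∀ k ∈ isoSet X ∩ (U ∩ ψ ⁻¹' (W ∩ Φ.source)),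
      Q k ∈ Φ.target ∧ Φ.symm (Q k) = ψ k := by
    rintro k ⟨hk, hkU, hkW, hks⟩
    have h1 := Φ.map_source hks
    have h2 := Φ.left_inv hks
    rw [hΦ', (hr k hk hkU).2] at h1 h2
    exact ⟨h1, h2⟩
  -- Openness onto the orbit excludes points of the orbit near h.p that come only from isometries
  -- outside the chart; an injective immersion alone would not.
  obtain ⟨V', hV', hOV⟩ := exists_isOpen_orbitMap_image p hU₀
  refine ⟨_, V', hU₀, hV', ⟨hhU, ?_⟩, ?_, ?_, fun y => isoParam h (Φ.symm (P y)), ?_, ?_, ?_, ?_⟩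
  · have h1 := (hl 0 h0W).2
    rw [isoParam_zero] at h1
    rw [mem_preimage, h1]
    exact ⟨h0W, h0Φ⟩
  · intro k hk
    rw [hOV]
    exact ⟨k, hk, rfl⟩
  · intro k _
    refine ⟨univ, mem_univ _, (affineAct p).rangeRestrict, ?_, fun _ _ => rfl⟩
    refine (smoothOnOpen_iff (ContinuousLinearEquiv.refl ℝ _) toEuclidean).2 ⟨isOpen_univ, ?_⟩
    exact ((toEuclidean (E := affineOrbit p)).toContinuousLinearMap.comp (orbitMap p)).contDiff.contDiffOn
  · intro y hy
    rw [hOV] at hy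
    obtain ⟨k, hk, rfl⟩ := hy
    have h1 : Φ.symm (P (orbitMap p k)) = ψ k := (hθP k hk).2
    change isoParam h (Φ.symm (P (orbitMap p k))) ∈ _
    rw [h1, (hr k hk.1 hk.2.1).2]
    exact hk
  · intro y hy
    refine ⟨P ⁻¹' Φ.target, ?_, fun y => isoParam h (Φ.symm (P y)), ?_, fun _ _ => rfl⟩
    · rw [hOV] at hy
      obtain ⟨k, hk, rfl⟩ := hy
      exact (hθP k hk).1
    · refine (smoothOnOpen_iff toEuclidean (ContinuousLinearEquiv.refl ℝ _)).2
        ⟨Φ.open_target.preimage P.continuous, ?_⟩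
      have h1 := ((contDiff_isoParam h).comp_contDiffOn hθ).of_le (m := ∞) le_top
      refine h1.comp (P.comp
        (toEuclidean (E := affineOrbit p)).symm.toContinuousLinearMap).contDiff.contDiffOn ?_
      rintro _ ⟨y, hy, rfl⟩
      simpa using hy
  · intro k hk
    have h1 : Φ.symm (P (orbitMap p k)) = ψ k := (hθP k hk).2
    change isoParam h (Φ.symm (P (orbitMap p k))) = k
    rw [h1, (hr k hk.1 hk.2.1).2]
  · intro y hy
    rw [hOV] at hy
    obtain ⟨k, hk, rfl⟩ := hy
    have h1 : Φ.symm (P (orbitMap p k)) = ψ k := (hθP k hk).2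
    change orbitMap p (isoParam h (Φ.symm (P (orbitMap p k)))) = orbitMap p k
    rw [h1, (hr k hk.1 hk.2.1).2]

theorem injective_of_isFull {p : S → X} (hp : IsFull p) :
    Function.Injective (tangentAct p) := by
  set i := ContinuousAffineMap.id ℝ X with hidef
  have hi : i ∈ isoSet X := id_mem_isoSet
  obtain ⟨-, hloc⟩ := hp
  obtain ⟨U, V, hU, hV, hiU, hm, -, g, -, hgs, hgf, -⟩ := hloc i hi
  let ε : affineOrbit p ≃L[ℝ] _ := toEuclidean
  obtain ⟨g₁, hg₁, hgg₁⟩ := hgs.exists_differentiableAt ε (ContinuousLinearEquiv.refl ℝ _)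
    (hm ⟨hi, hiU⟩)
  have hpc : Tendsto (isoParam i) (𝓝 0) (𝓝 i) := by
    have := (contDiff_isoParam i).continuous.tendsto 0
    rwa [isoParam_zero] at this
  have hjc : Tendsto (fun w => orbitMap p (isoParam i w)) (𝓝 0) (𝓝 (orbitMap p i)) :=
    ((orbitMap p).continuous.tendsto i).comp hpc
  have hev : ∀ᶠ w in 𝓝 (0 : X × linIsoLie X), g₁ (orbitMap p (isoParam i w)) = isoParam i w := by
    filter_upwards [hpc.eventually (hU.mem_nhds hiU), hjc.eventually hgg₁] with w h1 h2
    have hm' : isoParam i w ∈ isoSet X ∩ U := ⟨isoParam_mem hi w, h1⟩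
    exact (h2 (hm hm')).symm.trans (hgf hm')
  let T : (X →ᴬ[ℝ] X) →L[ℝ] EuclideanSpace ℝ (Fin (finrank ℝ (affineOrbit p))) :=
    (ε : affineOrbit p →L[ℝ] _).comp (orbitMap p)
  have hT : HasFDerivAt (fun w => T (isoParam i w)) (T.comp (isoParamDeriv i)) 0 :=
    T.hasFDerivAt.comp 0 (hasFDerivAt_isoParam i)
  have hg₁' : DifferentiableAt ℝ (fun z => g₁ (ε.symm z)) (T (isoParam i 0)) := by
    rw [isoParam_zero]
    exact hg₁
  have hcomp := hg₁'.hasFDerivAt.comp 0 hT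
  -- Near 0 the extended inverse composed with the orbit map reproduces `isoParam i`. The chain rule
  -- factors `isoParamDeriv i` through the derivative of the orbit map, which must then be
  -- injective.
  have huniq := (hcomp.congr_of_eventuallyEq (hev.mono fun w hw => by
    simp only [Function.comp, T, ContinuousLinearMap.comp_apply, ContinuousLinearEquiv.coe_coe,
      ContinuousLinearEquiv.symm_apply_apply, hw] :
      isoParam i =ᶠ[𝓝 0] _)).unique (hasFDerivAt_isoParam i)
  intro w z hwz
  have h1 : orbitMap p (isoParamDeriv i w) = orbitMap p (isoParamDeriv i z) := Subtype.ext hwz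
  have h2 : isoParamDeriv i w = isoParamDeriv i z := by
    rw [← huniq]
    simp only [ContinuousLinearMap.comp_apply, T, h1]
  have hcl : i.contLinear = 1 := by ext; rfl
  rw [isoParamDeriv_apply, isoParamDeriv_apply, hcl, one_mul, one_mul] at h2
  have h3 := Prod.ext_iff.1 ((affineOfPair X).injective h2)
  exact Prod.ext h3.1 (Subtype.ext h3.2)

end Full

theorem mainTheorem4 {X : Type*} [NormedAddCommGroup X] [NormedSpace ℝ X] [FiniteDimensional ℝ X]
    {S : Type*} [Nonempty S] (p : S → X) :
    ∃ n : ℕ, (∀ k : ℕ, IsSmoothManifoldOfDim (isoSet X) k ↔ k = n) ∧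
      ∃ T : Submodule ℝ (S → X), (T : Set (S → X)) = trivialMotions p ∧ FiniteDimensional ℝ T ∧
        Module.finrank ℝ X ≤ Module.finrank ℝ T ∧ Module.finrank ℝ T ≤ n ∧
        (Module.finrank ℝ T = n ↔ IsFull p) := by
  refine ⟨finrank ℝ (X × linIsoLie X),
    fun k => ⟨eq_finrank_of_isSmoothManifoldOfDim_isoSet,
      fun hk => hk ▸ isSmoothManifoldOfDim_isoSet⟩,
    LinearMap.range (tangentAct p), coe_range_tangentAct p, inferInstance,
    finrank_le_finrank_range_tangentAct p, (tangentAct p).finrank_range_le, ?_⟩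
  rw [finrank_range_tangentAct_eq_iff]
  exact ⟨isFull_of_injective, injective_of_isFull⟩
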